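/- Let $q(t)\in\mathbb{C}[t]$ be a polynomial of degree $n\ge 4$. Put $\rho=2q(-\tfrac12)$ and \[ p(t)=\frac{-4q(t)q(-t-1)+\rho^2}{(1+2t)^2}, \] which is a polynomial in $\mathbb{C}[t]$, and let $p_0,p_1\in\mathbb{C}[t]$ be determined by $p(t)=p_0(t^2)+p_1(t^2)t$. Let $D(q)$ (the noncommutative Kleinian singularity of type $D$) be the associative unital $\mathbb{C}$-algebra with generators $u,v,w$ and defining relations \[ [u,v]=2w+v,\qquad [u,w]=2vu+w+\rho,\qquad [v,w]=-v^2-p_1(u),\qquad w^2=v^2u+vw+\rho v+p_0(u), \] where $[x,y]=xy-yx$. Then the subalgebra $\mathbb{C}[u]$ of $D(q)$ generated by $u$ is maximal commutative in $D(q)$: it is commutative, and no commutative subalgebra of $D(q)$ properly contains it. -/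

import Mathlib

open Polynomial

namespace KleinianD

noncomputable section

/-- The constant `ρ = 2 q(-1/2)`. -/
def rho (q : ℂ[X]) : ℂ := 2 * q.eval (-(1 / 2))

/-- The polynomial `p(t) = (-4 q(t) q(-t-1) + ρ²) / (1+2t)²`. The division is exact,
see `pPoly_mul`. -/
def pPoly (q : ℂ[X]) : ℂ[X] :=
  (-4 * q * q.comp (-X - 1) + C (rho q ^ 2)) / (1 + 2 * X) ^ 2

/-- The polynomial `p₀` in `p(t) = p₀(t²) + p₁(t²) t`. -/
def p0 (q : ℂ[X]) : ℂ[X] := (pPoly q).contract 2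

/-- The polynomial `p₁` in `p(t) = p₀(t²) + p₁(t²) t`. -/
def p1 (q : ℂ[X]) : ℂ[X] := (pPoly q).divX.contract 2

/-- The names of the three generators. -/
inductive Gen : Type
  | u
  | v
  | w

/-- The generator `u` of the free algebra on `u, v, w`. -/
abbrev fu : FreeAlgebra ℂ Gen := FreeAlgebra.ι ℂ Gen.u

/-- The generator `v` of the free algebra on `u, v, w`. -/
abbrev fv : FreeAlgebra ℂ Gen := FreeAlgebra.ι ℂ Gen.v

/-- The generator `w` of the free algebra on `u, v, w`. -/
abbrev fw : FreeAlgebra ℂ Gen := FreeAlgebra.ι ℂ Gen.w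

/-- The defining relations of `D(q)`. -/
inductive Rel (q : ℂ[X]) : FreeAlgebra ℂ Gen → FreeAlgebra ℂ Gen → Prop
  | uv : Rel q (fu * fv - fv * fu) (2 * fw + fv)
  | uw : Rel q (fu * fw - fw * fu)
      (2 * (fv * fu) + fw + algebraMap ℂ (FreeAlgebra ℂ Gen) (rho q))
  | vw : Rel q (fv * fw - fw * fv) (-fv ^ 2 - aeval fu (p1 q))
  | ww : Rel q (fw ^ 2) (fv ^ 2 * fu + fv * fw + rho q • fv + aeval fu (p0 q))

/-- The noncommutative type `D` Kleinian singularity `D(q)`: the unital associative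
`ℂ`-algebra with generators `u, v, w` and the relations `Rel q`. -/
abbrev D (q : ℂ[X]) : Type := RingQuot (Rel q)

/-- The generator `u` of `D(q)`. -/
def u (q : ℂ[X]) : D q := RingQuot.mkAlgHom ℂ (Rel q) fu

/-- The generator `v` of `D(q)`. -/
def v (q : ℂ[X]) : D q := RingQuot.mkAlgHom ℂ (Rel q) fv

/-- The generator `w` of `D(q)`. -/
def w (q : ℂ[X]) : D q := RingQuot.mkAlgHom ℂ (Rel q) fw

/-- The subalgebra `ℂ[u]` of `D(q)` generated by `u`. -/
def Cu (q : ℂ[X]) : Subalgebra ℂ (D q) := Algebra.adjoin ℂ {u q}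

/-- A subalgebra is maximal commutative if it is commutative and no commutative subalgebra
properly contains it. -/
def IsMaximalCommutative {A : Type*} [Ring A] [Algebra ℂ A] (B : Subalgebra ℂ A) : Prop :=
  Maximal (fun S : Subalgebra ℂ A => IsMulCommutative S) B

theorem pPoly_mul (q : ℂ[X]) :
    pPoly q * (1 + 2 * X) ^ 2 = -4 * q * q.comp (-X - 1) + C (rho q ^ 2) := by
  set N : ℂ[X] := -4 * q * q.comp (-X - 1) + C (rho q ^ 2) with hN
  have hroot : N.eval (-(1 / 2)) = 0 := by
    simp only [hN, rho, eval_add, eval_mul, eval_comp, eval_sub, eval_neg, eval_X, eval_one,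
      eval_C, eval_ofNat]
    have : (- -(1 / 2) - 1 : ℂ) = -(1 / 2) := by norm_num
    rw [this]; ring
  have hsymm : N.comp (-X - 1) = N := by
    have h : ((-X - 1 : ℂ[X])).comp (-X - 1) = X := by
      simp
    simp only [hN, add_comp, mul_comp, neg_comp, C_comp, comp_assoc, h, comp_X, ofNat_comp]
    ring
  have hlin : (1 + 2 * X : ℂ[X]) = C 2 * (X - C (-(1 / 2))) := by
    rw [mul_sub, ← C_mul]; norm_num; rw [show (C 2 : ℂ[X]) = 2 from rfl]; ring
  obtain ⟨M, hM⟩ := dvd_iff_isRoot.mpr (show N.IsRoot (-(1 / 2)) from hroot)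
  have hMr : M.eval (-(1 / 2)) = 0 := by
    have hd : N.derivative.eval (-(1 / 2)) = 0 := by
      have := congrArg (fun f => (derivative f).eval (-(1 / 2) : ℂ)) hsymm
      simp only [derivative_comp, eval_mul, eval_comp, derivative_sub, derivative_neg,
        derivative_X, derivative_one, eval_sub, eval_neg, eval_X, eval_one, eval_zero] at this
      have e : (- -(1 / 2) - 1 : ℂ) = -(1 / 2) := by norm_num
      rw [e] at this
      linear_combination (-1 / 2 : ℂ) * this
    rw [hM] at hd
    simpa using hd
  obtain ⟨K, hK⟩ := dvd_iff_isRoot.mpr (show M.IsRoot (-(1 / 2)) from hMr)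
  have hdvd : (1 + 2 * X : ℂ[X]) ^ 2 ∣ N := by
    refine ⟨C (1 / 4) * K, ?_⟩
    rw [hM, hK, hlin]
    have : (C 2 * C 2 * C (1 / 4) : ℂ[X]) = 1 := by
      rw [← C_mul, ← C_mul]; norm_num
    linear_combination (-(X - C (-(1 / 2))) ^ 2 * K) * this
  rw [pPoly, ← hN, mul_comm]
  exact EuclideanDomain.mul_div_cancel' (by
    rw [hlin]; exact pow_ne_zero _ (mul_ne_zero (by simp) (X_sub_C_ne_zero _))) hdvd

theorem pPoly_eq (q : ℂ[X]) :
    pPoly q = (p0 q).comp (X ^ 2) + (p1 q).comp (X ^ 2) * X := by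
  rw [← expand_eq_comp_X_pow, ← expand_eq_comp_X_pow]
  ext n
  rcases n with _ | n
  · simp [p0, coeff_contract, coeff_expand]
  · rw [coeff_add, coeff_mul_X, coeff_expand (by norm_num), coeff_expand (by norm_num)]
    simp only [p0, p1, coeff_contract (two_ne_zero), coeff_divX]
    rcases Nat.even_or_odd n with h | h
    · have h1 : 2 ∣ n := h.two_dvd
      have h2 : ¬ 2 ∣ n + 1 := by omega
      rw [if_neg h2, if_pos h1, Nat.div_mul_cancel h1, zero_add]
    · have h2 : 2 ∣ n + 1 := h.add_one.two_dvd
      have h1 : ¬ 2 ∣ n := by omega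
      rw [if_pos h2, if_neg h1, Nat.div_mul_cancel h2, add_zero]

end

end KleinianD

/-!
Filter `D(q)` by `F₀ = ℂ[u]` and `Fₙ₊₁ = ℂ[u] + w ℂ[u] + v Fₙ`; the relations, which move `u`
and `w` to the right past `v`, show that left multiplication by `u` preserves each `Fₙ`, while
`v` and `w` map `Fₙ` into `Fₙ₊₁`, so the filtration is exhaustive.

On functions on the lattice `s ∈ i + ℤ`, let `u` act as multiplication by `s²`, and `v`, `w` as
difference operators with leading parts `f ↦ f(s + 1)` and `f ↦ -(s + 1) f(s + 1)`. An element `x`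
of `Fₙ₊₁` sends the point mass at `s` to a function whose lowest possible node is `s - (n + 1)`,
and if its value there vanishes for all `s`, then `x ∈ Fₙ`: on removing factors `v` this becomes the
fact that `f(s²) = s g(s²)` for all `s` only if the polynomials `f`, `g` are zero. Since the
numbers `s²` are pairwise distinct, an `x` that commutes with `u` maps each point mass to a multiple
of itself. Such an `x` therefore descends from each `Fₙ₊₁` to `Fₙ`, and so lies in `ℂ[u]`.
-/

namespace KleinianD

noncomputable section

section Generalities

theorem isMaximalCommutative_adjoin_singleton {A : Type*} [Ring A] [Algebra ℂ A] {a : A}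
    (h : Subalgebra.centralizer ℂ {a} ≤ Algebra.adjoin ℂ {a}) :
    IsMaximalCommutative (Algebra.adjoin ℂ {a}) := by
  refine ⟨inferInstance, fun S _ haS x hx => h ?_⟩
  rw [Subalgebra.mem_centralizer_iff]
  rintro _ rfl
  exact setLike_mul_comm (haS (Algebra.self_mem_adjoin_singleton ℂ _)) hx

variable {R A : Type*} [CommSemiring R]

theorem mul_mem_of_mem_adjoin [Semiring A] [Algebra R A] {s : Set A} {M : Submodule R A}
    (hM : ∀ a ∈ s, ∀ x ∈ M, a * x ∈ M) {a : A} (ha : a ∈ Algebra.adjoin R s) :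
    ∀ x ∈ M, a * x ∈ M := by
  induction ha using Algebra.adjoin_induction with
  | mem a ha => exact hM a ha
  | algebraMap r => exact fun x hx => by simpa only [← Algebra.smul_def] using M.smul_mem r hx
  | add a b _ _ ha hb => exact fun x hx => add_mul a b x ▸ add_mem (ha x hx) (hb x hx)
  | mul a b _ _ ha hb => exact fun x hx => mul_assoc a b x ▸ ha _ (hb x hx)

theorem eq_zero_of_expand_two_eq_expand_two_mul_X {f g : R[X]}
    (h : expand R 2 f = expand R 2 g * X) : f = 0 ∧ g = 0 := by
  refine ⟨ext fun n => ?_, ext fun n => ?_⟩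
  · have hn := congrArg (coeff · (2 * n)) h
    rcases n with _ | n
    · simpa [coeff_expand two_pos] using hn
    · have hodd : ¬ 2 ∣ 2 * n + 1 := by omega
      simpa [mul_add, coeff_mul_X, coeff_expand two_pos, hodd] using hn
  · have hodd : ¬ 2 ∣ 2 * n + 1 := by omega
    simpa [coeff_mul_X, coeff_expand two_pos, hodd] using (congrArg (coeff · (2 * n + 1)) h).symm

end Generalities

section Relations

variable (q : ℂ[X])

theorem u_mul_v : u q * v q = v q * u q + 2 * w q + v q := by
  have h := RingQuot.mkAlgHom_rel ℂ (Rel.uv (q := q))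
  simp only [map_sub, map_mul, map_add, map_ofNat] at h
  rw [add_assoc, add_comm]
  exact sub_eq_iff_eq_add.1 h

theorem u_mul_w :
    u q * w q = w q * u q + 2 * (v q * u q) + w q + algebraMap ℂ (D q) (rho q) := by
  have h := RingQuot.mkAlgHom_rel ℂ (Rel.uw (q := q))
  simp only [map_sub, map_mul, map_add, map_ofNat, AlgHom.commutes] at h
  rw [add_assoc, add_assoc, ← add_assoc (2 * _), add_comm]
  exact sub_eq_iff_eq_add.1 h

theorem w_mul_v : w q * v q = v q * w q + v q * v q + aeval (u q) (p1 q) := by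
  have h := RingQuot.mkAlgHom_rel ℂ (Rel.vw (q := q))
  simp only [map_sub, map_mul, map_neg, map_pow, ← aeval_algHom_apply] at h
  change v q * w q - w q * v q = -v q ^ 2 - aeval (u q) (p1 q) at h
  rw [sub_eq_iff_eq_add.1 h, pow_two]
  abel

theorem w_mul_w :
    w q * w q = v q * (v q * u q) + v q * w q + rho q • v q + aeval (u q) (p0 q) := by
  have h := RingQuot.mkAlgHom_rel ℂ (Rel.ww (q := q))
  simp only [map_mul, map_add, map_smul, ← aeval_algHom_apply, pow_two, mul_assoc] at h
  exact h

theorem adjoin_generators : Algebra.adjoin ℂ {u q, v q, w q} = ⊤ := by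
  have hrange : Set.range (RingQuot.mkAlgHom ℂ (Rel q) ∘ FreeAlgebra.ι ℂ) = {u q, v q, w q} := by
    ext x
    simp only [Set.mem_range, Function.comp_apply, Set.mem_insert_iff, Set.mem_singleton_iff]
    constructor
    · rintro ⟨_ | _ | _, rfl⟩
      exacts [.inl rfl, .inr (.inl rfl), .inr (.inr rfl)]
    · rintro (rfl | rfl | rfl)
      exacts [⟨.u, rfl⟩, ⟨.v, rfl⟩, ⟨.w, rfl⟩]
  rw [← hrange, Set.range_comp, ← AlgHom.map_adjoin, FreeAlgebra.adjoin_range_ι,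
    Algebra.map_top, AlgHom.range_eq_top]
  exact RingQuot.mkAlgHom_surjective ℂ (Rel q)

end Relations

section Filtration

variable {q : ℂ[X]}

theorem u_mem_Cu : u q ∈ Cu q := Algebra.self_mem_adjoin_singleton ℂ _

theorem aeval_u_mem_Cu (f : ℂ[X]) : aeval (u q) f ∈ Cu q := aeval_mem_adjoin_singleton ℂ _

theorem exists_aeval_u_of_mem_Cu {x : D q} (hx : x ∈ Cu q) : ∃ f : ℂ[X], aeval (u q) f = x := by
  rwa [Cu, Algebra.adjoin_singleton_eq_range_aeval] at hx

/-- The filtration `F₀ = ℂ[u]`, `Fₙ₊₁ = ℂ[u] + w ℂ[u] + v Fₙ` of `D(q)`; thus `Fₙ` is the span of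
`v ^ j ℂ[u]` for `j ≤ n` and of `v ^ j w ℂ[u]` for `j < n`. The recursion peels off the leftmost
factor `v`, so that left multiplication by `v` maps `Fₙ` into `Fₙ₊₁` by construction. -/
def filtration (q : ℂ[X]) : ℕ → Submodule ℂ (D q)
  | 0 => Subalgebra.toSubmodule (Cu q)
  | n + 1 => Subalgebra.toSubmodule (Cu q) ⊔
      (Subalgebra.toSubmodule (Cu q)).map (LinearMap.mulLeft ℂ (w q)) ⊔
      (filtration q n).map (LinearMap.mulLeft ℂ (v q))

theorem mem_filtration_succ {n : ℕ} {x : D q} : x ∈ filtration q (n + 1) ↔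
    ∃ a ∈ Cu q, ∃ b ∈ Cu q, ∃ y ∈ filtration q n, a + w q * b + v q * y = x := by
  simp [filtration, Submodule.mem_sup]

theorem Cu_le_filtration (n : ℕ) : Subalgebra.toSubmodule (Cu q) ≤ filtration q n := by
  cases n with
  | zero => exact le_rfl
  | succ n => exact le_sup_left.trans le_sup_left

theorem filtration_mono : Monotone (filtration q) := by
  refine monotone_nat_of_le_succ fun n => ?_
  induction n with
  | zero => exact Cu_le_filtration 1
  | succ n ih => exact sup_le_sup_left (Submodule.map_mono ih) _

theorem v_mul_mem_filtration {n : ℕ} {y : D q} (hy : y ∈ filtration q n) :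
    v q * y ∈ filtration q (n + 1) :=
  Submodule.mem_sup_right (Submodule.mem_map_of_mem hy)

theorem w_mul_mem_filtration_of_mem_Cu (n : ℕ) {b : D q} (hb : b ∈ Cu q) :
    w q * b ∈ filtration q (n + 1) :=
  Submodule.mem_sup_left (Submodule.mem_sup_right (Submodule.mem_map_of_mem hb))

theorem u_mul_mem_filtration_succ {n : ℕ} (hu : ∀ y ∈ filtration q n, u q * y ∈ filtration q n)
    (hw : ∀ y ∈ filtration q n, w q * y ∈ filtration q (n + 1)) :
    ∀ x ∈ filtration q (n + 1), u q * x ∈ filtration q (n + 1) := by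
  intro x hx
  obtain ⟨a, ha, b, hb, y, hy, rfl⟩ := mem_filtration_succ.1 hx
  have hub : u q * b ∈ Cu q := mul_mem u_mem_Cu hb
  have expand_mul : u q * (a + w q * b + v q * y) =
      (u q * a + rho q • b) + w q * (u q * b + b) +
        v q * (2 • (u q * b) + u q * y + y) + 2 • (w q * y) := by
    simp only [mul_add, ← mul_assoc, u_mul_v, u_mul_w, add_mul, two_mul,
      mul_smul_comm, Algebra.smul_def (rho q)]
    abel
  rw [expand_mul]
  refine add_mem (mem_filtration_succ.2
    ⟨_, add_mem (mul_mem u_mem_Cu ha) ((Cu q).smul_mem hb _), _, add_mem hub hb, _, ?_, rfl⟩)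
    (Submodule.smul_mem _ _ (hw y hy))
  exact add_mem (add_mem (Submodule.smul_mem _ _ (Cu_le_filtration n hub)) (hu y hy)) hy

theorem w_mul_mem_filtration_succ {n : ℕ} (hu : ∀ y ∈ filtration q n, u q * y ∈ filtration q n)
    (hw : ∀ y ∈ filtration q n, w q * y ∈ filtration q (n + 1)) :
    ∀ x ∈ filtration q (n + 1), w q * x ∈ filtration q (n + 2) := by
  intro x hx
  obtain ⟨a, ha, b, hb, y, hy, rfl⟩ := mem_filtration_succ.1 hx
  have hub : u q * b ∈ Cu q := mul_mem u_mem_Cu hb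
  have hp1y : aeval (u q) (p1 q) * y ∈ filtration q n :=
    mul_mem_of_mem_adjoin (by simpa using hu) (aeval_u_mem_Cu (p1 q)) y hy
  have expand_mul : w q * (a + w q * b + v q * y) =
      aeval (u q) (p0 q) * b + w q * a +
        v q * (v q * (u q * b) + w q * b + rho q • b + w q * y + v q * y) +
        aeval (u q) (p1 q) * y := by
    simp only [mul_add, ← mul_assoc, w_mul_v, w_mul_w, add_mul, smul_mul_assoc, mul_smul_comm]
    abel
  rw [expand_mul]
  refine add_mem (mem_filtration_succ.2
    ⟨_, mul_mem (aeval_u_mem_Cu _) hb, _, ha, _, ?_, rfl⟩) (filtration_mono (by lia) hp1y)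
  refine add_mem (add_mem (add_mem (add_mem ?_ ?_) ?_) (hw y hy)) (v_mul_mem_filtration hy)
  · exact v_mul_mem_filtration (Cu_le_filtration n hub)
  · exact w_mul_mem_filtration_of_mem_Cu n hb
  · exact Cu_le_filtration _ ((Cu q).smul_mem hb _)

theorem u_mul_mem_and_w_mul_mem_filtration (n : ℕ) :
    (∀ y ∈ filtration q n, u q * y ∈ filtration q n) ∧
      ∀ y ∈ filtration q n, w q * y ∈ filtration q (n + 1) := by
  induction n with
  | zero =>
    exact ⟨fun _ hy => (Cu q).mul_mem u_mem_Cu hy, fun _ hy => w_mul_mem_filtration_of_mem_Cu 0 hy⟩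
  | succ n ih =>
    exact ⟨u_mul_mem_filtration_succ ih.1 ih.2, w_mul_mem_filtration_succ ih.1 ih.2⟩

theorem exists_mem_filtration (x : D q) : ∃ n, x ∈ filtration q n := by
  have mem_iSup {x : D q} : x ∈ ⨆ n, filtration q n ↔ ∃ n, x ∈ filtration q n :=
    Submodule.mem_iSup_of_directed _ filtration_mono.directed_le
  have generator_mul_mem : ∀ a ∈ ({u q, v q, w q} : Set (D q)), ∀ y ∈ ⨆ n, filtration q n,
      a * y ∈ ⨆ n, filtration q n := by
    intro a ha y hy
    obtain ⟨n, hn⟩ := mem_iSup.1 hy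
    obtain ⟨hu, hw⟩ := u_mul_mem_and_w_mul_mem_filtration (q := q) n
    rcases ha with rfl | rfl | rfl
    · exact mem_iSup.2 ⟨n, hu y hn⟩
    · exact mem_iSup.2 ⟨n + 1, v_mul_mem_filtration hn⟩
    · exact mem_iSup.2 ⟨n + 1, hw y hn⟩
  have hx : x ∈ Algebra.adjoin ℂ {u q, v q, w q} := adjoin_generators q ▸ Algebra.mem_top
  rw [← mem_iSup, ← mul_one x]
  exact mul_mem_of_mem_adjoin generator_mul_mem hx 1 (mem_iSup.2 ⟨0, (Cu q).one_mem⟩)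

end Filtration

section DifferenceOperators

/-- The `n`-th point of the lattice `i + ℤ` on which difference operators act. Any translate of `ℤ`
off `½ℤ` would do: the coefficients below have poles in `½ℤ`, and the squares of the nodes have to
be pairwise distinct. -/
def node (n : ℤ) : ℂ := Complex.I + n

theorem node_add_one (n : ℤ) : node (n + 1) = node n + 1 := by
  simp [node, add_assoc]

theorem node_sub_one (n : ℤ) : node (n - 1) = node n - 1 := by
  simp [node, add_sub_assoc]

theorem node_im (n : ℤ) : (node n).im = 1 := by
  simp [node]

theorem node_im_ne_zero (n : ℤ) : (node n).im ≠ 0 := by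
  simp [node_im]

theorem node_injective : Function.Injective node := fun m n h => by
  simpa [node] using h

theorem node_sq_injective : Function.Injective fun n => node n ^ 2 := by
  intro m n h
  rcases sq_eq_sq_iff_eq_or_eq_neg.1 h with h | h
  · exact node_injective h
  · have him := congrArg Complex.im h
    norm_num [node_im] at him

theorem eq_zero_of_eval_node_sq {f g : ℂ[X]}
    (h : ∀ n, f.eval (node n ^ 2) = g.eval (node n ^ 2) * node n) : f = 0 ∧ g = 0 := by
  refine eq_zero_of_expand_two_eq_expand_two_mul_X (eq_of_infinite_eval_eq _ _
    ((Set.infinite_range_of_injective node_injective).mono ?_))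
  rintro _ ⟨n, rfl⟩
  simpa [expand_eval] using h n

/-- The second order difference operator `f ↦ a(s) f(s + 1) + b(s) f(s) + c(s) f(s - 1)` on
functions on the lattice, where a function is indexed by `n` rather than by `s = node n`. -/
def diffOp (a b c : ℂ → ℂ) : Module.End ℂ (ℤ → ℂ) where
  toFun f n := a (node n) * f (n + 1) + b (node n) * f n + c (node n) * f (n - 1)
  map_add' f g := by ext n; simp only [Pi.add_apply]; ring
  map_smul' r f := by ext n; simp only [Pi.smul_apply, smul_eq_mul, RingHom.id_apply]; ring

theorem diffOp_apply (a b c : ℂ → ℂ) (f : ℤ → ℂ) (n : ℤ) : diffOp a b c f n =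
    a (node n) * f (n + 1) + b (node n) * f n + c (node n) * f (n - 1) := rfl

/-- The functions on the lattice that are zero at all nodes of index less than `m`. -/
def vanishingBelow (m : ℤ) : Submodule ℂ (ℤ → ℂ) := Submodule.pi (Set.Iio m) fun _ => ⊥

theorem mem_vanishingBelow {m : ℤ} {f : ℤ → ℂ} : f ∈ vanishingBelow m ↔ ∀ k < m, f k = 0 := by
  simp [vanishingBelow, Submodule.mem_pi]

theorem vanishingBelow_antitone : Antitone vanishingBelow := fun _ _ hmn _ hf =>
  mem_vanishingBelow.2 fun k hk => mem_vanishingBelow.1 hf k (hk.trans_le hmn)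

theorem single_mem_vanishingBelow (m : ℤ) : Pi.single m 1 ∈ vanishingBelow m :=
  mem_vanishingBelow.2 fun _ hk => Pi.single_eq_of_ne hk.ne _

theorem diffOp_mem_vanishingBelow (a b c : ℂ → ℂ) {f : ℤ → ℂ} {m : ℤ}
    (hf : f ∈ vanishingBelow m) : diffOp a b c f ∈ vanishingBelow (m - 1) := by
  rw [mem_vanishingBelow] at hf ⊢
  intro k hk
  rw [diffOp_apply, hf (k + 1) (by lia), hf k (by lia), hf (k - 1) (by lia)]
  ring

theorem diffOp_apply_sub_one (a b c : ℂ → ℂ) {f : ℤ → ℂ} {m : ℤ} (hf : f ∈ vanishingBelow m) :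
    diffOp a b c f (m - 1) = a (node m - 1) * f m := by
  rw [mem_vanishingBelow] at hf
  rw [diffOp_apply, hf (m - 1) (by lia), hf (m - 1 - 1) (by lia), sub_add_cancel, node_sub_one]
  ring

end DifferenceOperators

section Coefficients

/-- The coefficient of `f(s)` in the action of `v`: with `u` acting as `s²`, the relation for
`[u, w]` forces it. -/
def midCoeff (q : ℂ[X]) (s : ℂ) : ℂ := 2 * rho q / ((1 - 2 * s) * (1 + 2 * s))

/-- The coefficient of `f(s - 1)` in the action of `v`: with the coefficient of `f(s + 1)`
normalized to `1`, the relations for `[v, w]` and `w²` together force it. -/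
def downCoeff (q : ℂ[X]) (s : ℂ) : ℂ :=
  q.eval (s - 1) * q.eval (-s) / (s * (s - 1) * (2 * s - 1) ^ 2)

variable (q : ℂ[X]) {s : ℂ}

theorem midCoeff_neg (s : ℂ) : midCoeff q (-s) = midCoeff q s := by
  rw [midCoeff, midCoeff]
  ring_nf

theorem downCoeff_one_sub (s : ℂ) : downCoeff q (1 - s) = downCoeff q s := by
  rw [downCoeff, downCoeff, sub_sub_cancel_left, neg_sub, mul_comm (q.eval (-s))]
  ring_nf

theorem midCoeff_mul (hs : s.im ≠ 0) :
    midCoeff q s * ((1 - 2 * s) * (1 + 2 * s)) = 2 * rho q := by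
  have h₁ : 1 - 2 * s ≠ 0 := ne_of_apply_ne Complex.im (by simpa using hs)
  have h₂ : 1 + 2 * s ≠ 0 := ne_of_apply_ne Complex.im (by simpa using hs)
  exact div_mul_cancel₀ _ (mul_ne_zero h₁ h₂)

theorem midCoeff_add_one_mul (hs : s.im ≠ 0) :
    midCoeff q (s + 1) * (s + 3 / 2) = midCoeff q s * (s - 1 / 2) := by
  have h : 1 + 2 * s ≠ 0 := ne_of_apply_ne Complex.im (by simpa using hs)
  have hs' : (s + 1).im ≠ 0 := by simpa using hs
  apply mul_right_cancel₀ h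
  linear_combination (midCoeff_mul q hs - midCoeff_mul q hs') / 2

theorem downCoeff_add_one_mul (hs : s.im ≠ 0) :
    downCoeff q (s + 1) * (s * (s + 1) * (1 + 2 * s) ^ 2) = q.eval s * q.eval (-s - 1) := by
  have h₀ : s ≠ 0 := ne_of_apply_ne Complex.im hs
  have h₁ : s + 1 ≠ 0 := ne_of_apply_ne Complex.im (by simpa using hs)
  have h₂ : 1 + 2 * s ≠ 0 := ne_of_apply_ne Complex.im (by simpa using hs)
  rw [downCoeff, add_sub_cancel_right, neg_add', show 2 * (s + 1) - 1 = 1 + 2 * s by ring,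
    mul_comm (s + 1) s]
  exact div_mul_cancel₀ _ (mul_ne_zero (mul_ne_zero h₀ h₁) (pow_ne_zero 2 h₂))

theorem eval_pPoly (s : ℂ) :
    (pPoly q).eval s = (p0 q).eval (s ^ 2) + (p1 q).eval (s ^ 2) * s := by
  simpa using congrArg (eval s) (pPoly_eq q)

theorem eval_pPoly_eq_coeffs (hs : s.im ≠ 0) : (pPoly q).eval s =
    midCoeff q s ^ 2 * (1 - 2 * s) ^ 2 / 4 - 4 * s * (s + 1) * downCoeff q (s + 1) := by
  have h : 1 + 2 * s ≠ 0 := ne_of_apply_ne Complex.im (by simpa using hs)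
  have hp : (pPoly q).eval s * (1 + 2 * s) ^ 2 =
      -4 * q.eval s * q.eval (-s - 1) + rho q ^ 2 := by
    simpa using congrArg (eval s) (pPoly_mul q)
  apply mul_right_cancel₀ (pow_ne_zero 2 h)
  linear_combination hp + 4 * downCoeff_add_one_mul q hs
    - (midCoeff q s * ((1 - 2 * s) * (1 + 2 * s)) + 2 * rho q) / 4 * midCoeff_mul q hs

theorem eval_pPoly_neg_eq_coeffs (hs : s.im ≠ 0) : (pPoly q).eval (-s) =
    midCoeff q s ^ 2 * (1 + 2 * s) ^ 2 / 4 - 4 * s * (s - 1) * downCoeff q s := by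
  rw [eval_pPoly_eq_coeffs q (by simpa using hs), midCoeff_neg, neg_add_eq_sub, downCoeff_one_sub]
  ring

theorem eval_p1_sq (hs : s.im ≠ 0) : (p1 q).eval (s ^ 2) =
    2 * (s - 1) * downCoeff q s - 2 * (s + 1) * downCoeff q (s + 1) - midCoeff q s ^ 2 := by
  have hpos := eval_pPoly q s
  have hneg := eval_pPoly q (-s)
  rw [eval_pPoly_eq_coeffs q hs] at hpos
  rw [eval_pPoly_neg_eq_coeffs q hs, neg_sq] at hneg
  apply mul_right_cancel₀ (ne_of_apply_ne Complex.im hs : s ≠ 0)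
  linear_combination (hneg - hpos) / 2

theorem eval_p0_sq (hs : s.im ≠ 0) : (p0 q).eval (s ^ 2) =
    midCoeff q s ^ 2 * (1 + 4 * s ^ 2) / 4
      - 2 * s * (s + 1) * downCoeff q (s + 1) - 2 * s * (s - 1) * downCoeff q s := by
  have hpos := eval_pPoly q s
  have hneg := eval_pPoly q (-s)
  rw [eval_pPoly_eq_coeffs q hs] at hpos
  rw [eval_pPoly_neg_eq_coeffs q hs, neg_sq] at hneg
  linear_combination -(hpos + hneg) / 2

end Coefficients

section Representation

/-- The operators by which the generators of `D(q)` act on functions on the lattice: `u` acts as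
multiplication by `s²`. Given `v`, the operator of `w` is forced by the relation for `[u, v]`. -/
def genOp (q : ℂ[X]) : Gen → Module.End ℂ (ℤ → ℂ)
  | .u => diffOp 0 (fun s => s ^ 2) 0
  | .v => diffOp 1 (midCoeff q) (downCoeff q)
  | .w => diffOp (fun s => -(s + 1)) (fun s => -midCoeff q s / 2) (fun s => (s - 1) * downCoeff q s)

variable (q : ℂ[X])

theorem genOp_u_apply (f : ℤ → ℂ) (n : ℤ) : genOp q .u f n = node n ^ 2 * f n := by
  simp [genOp, diffOp_apply]

theorem genOp_v_apply (f : ℤ → ℂ) (n : ℤ) : genOp q .v f n =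
    f (n + 1) + midCoeff q (node n) * f n + downCoeff q (node n) * f (n - 1) := by
  simp [genOp, diffOp_apply]

theorem genOp_w_apply (f : ℤ → ℂ) (n : ℤ) : genOp q .w f n =
    -(node n + 1) * f (n + 1) + -midCoeff q (node n) / 2 * f n
      + (node n - 1) * downCoeff q (node n) * f (n - 1) := rfl

theorem aeval_genOp_u_apply (p : ℂ[X]) (f : ℤ → ℂ) (n : ℤ) :
    aeval (genOp q .u) p f n = p.eval (node n ^ 2) * f n := by
  induction p using Polynomial.induction_on' with
  | add p r hp hr => simp [hp, hr, add_mul]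
  | monomial k c =>
    have hpow : (genOp q .u ^ k) f n = (node n ^ 2) ^ k * f n := by
      induction k with
      | zero => simp
      | succ k ih => rw [pow_succ', Module.End.mul_apply, genOp_u_apply, ih]; ring
    simp [aeval_monomial, Module.algebraMap_end_apply, hpow, mul_assoc]

theorem midCoeff_node_add_one (n : ℤ) :
    midCoeff q (node n + 1) * (node n + 3 / 2) = midCoeff q (node n) * (node n - 1 / 2) :=
  midCoeff_add_one_mul q (node_im_ne_zero n)

theorem midCoeff_node_sub_one (n : ℤ) :
    midCoeff q (node n) * (node n + 1 / 2) = midCoeff q (node n - 1) * (node n - 3 / 2) := by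
  have h := midCoeff_node_add_one q (n - 1)
  rw [node_sub_one, sub_add_cancel] at h
  linear_combination h

theorem genOp_uv : genOp q .u * genOp q .v - genOp q .v * genOp q .u =
    2 * genOp q .w + genOp q .v := by
  ext1 f; ext n
  simp only [two_mul, LinearMap.sub_apply, LinearMap.add_apply, Module.End.mul_apply, Pi.sub_apply,
    Pi.add_apply, genOp_u_apply, genOp_v_apply, genOp_w_apply, node_add_one, node_sub_one]
  ring

theorem genOp_uw : genOp q .u * genOp q .w - genOp q .w * genOp q .u =
    2 * (genOp q .v * genOp q .u) + genOp q .w + algebraMap ℂ _ (rho q) := by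
  ext1 f; ext n
  simp only [two_mul, LinearMap.sub_apply, LinearMap.add_apply, Module.End.mul_apply, Pi.sub_apply,
    Pi.add_apply, genOp_u_apply, genOp_v_apply, genOp_w_apply, node_add_one, node_sub_one,
    Module.algebraMap_end_apply, Pi.smul_apply, smul_eq_mul]
  linear_combination (1 / 2 : ℂ) * f n * midCoeff_mul q (node_im_ne_zero n)

theorem genOp_vw : genOp q .v * genOp q .w - genOp q .w * genOp q .v =
    -genOp q .v ^ 2 - aeval (genOp q .u) (p1 q) := by
  ext1 f; ext n
  simp only [pow_two (genOp q .v), LinearMap.sub_apply, LinearMap.neg_apply, Module.End.mul_apply,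
    Pi.sub_apply, Pi.neg_apply, aeval_genOp_u_apply, genOp_v_apply, genOp_w_apply, node_add_one,
    node_sub_one, add_sub_cancel_right, sub_add_cancel, eval_p1_sq q (node_im_ne_zero n)]
  linear_combination f (n + 1) * midCoeff_node_add_one q n
    + downCoeff q (node n) * f (n - 1) * midCoeff_node_sub_one q n

theorem genOp_ww : genOp q .w ^ 2 = genOp q .v ^ 2 * genOp q .u + genOp q .v * genOp q .w
    + rho q • genOp q .v + aeval (genOp q .u) (p0 q) := by
  ext1 f; ext n
  have hmid := midCoeff_mul q (node_im_ne_zero n)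
  simp only [pow_two (genOp q _), LinearMap.add_apply, LinearMap.smul_apply, Module.End.mul_apply,
    Pi.add_apply, Pi.smul_apply, smul_eq_mul, aeval_genOp_u_apply, genOp_u_apply, genOp_v_apply,
    genOp_w_apply, node_add_one, node_sub_one, add_sub_cancel_right, sub_add_cancel,
    eval_p0_sq q (node_im_ne_zero n)]
  linear_combination f (n + 1) * (hmid / 2 - node n * midCoeff_node_add_one q n)
    + downCoeff q (node n) * f (n - 1) * (hmid / 2 + node n * midCoeff_node_sub_one q n)
    + f n * midCoeff q (node n) / 2 * hmid

theorem lift_genOp_eq_of_rel {a b : FreeAlgebra ℂ Gen} (h : Rel q a b) :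
    FreeAlgebra.lift ℂ (genOp q) a = FreeAlgebra.lift ℂ (genOp q) b := by
  cases h with
  | uv => simpa [two_mul] using genOp_uv q
  | uw => simpa [two_mul] using genOp_uw q
  | vw => simpa [← aeval_algHom_apply] using genOp_vw q
  | ww => simpa [← aeval_algHom_apply] using genOp_ww q

/-- The representation of `D(q)` by difference operators on functions on the lattice. -/
def rep : D q →ₐ[ℂ] Module.End ℂ (ℤ → ℂ) :=
  RingQuot.liftAlgHom ℂ ⟨FreeAlgebra.lift ℂ (genOp q), fun _ _ => lift_genOp_eq_of_rel q⟩

theorem rep_u : rep q (u q) = genOp q .u := by simp [rep, u]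

theorem rep_v : rep q (v q) = genOp q .v := by simp [rep, v]

theorem rep_w : rep q (w q) = genOp q .w := by simp [rep, w]

theorem rep_aeval_u_apply (p : ℂ[X]) (f : ℤ → ℂ) (n : ℤ) :
    rep q (aeval (u q) p) f n = p.eval (node n ^ 2) * f n := by
  rw [← aeval_algHom_apply, rep_u, aeval_genOp_u_apply]

end Representation

section LeadingCoefficients

variable {q : ℂ[X]} {f : ℤ → ℂ} {m : ℤ}

theorem rep_mem_vanishingBelow_of_mem_Cu {a : D q} (ha : a ∈ Cu q) (hf : f ∈ vanishingBelow m) :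
    rep q a f ∈ vanishingBelow m := by
  obtain ⟨p, rfl⟩ := exists_aeval_u_of_mem_Cu ha
  rw [mem_vanishingBelow] at hf ⊢
  intro k hk
  rw [rep_aeval_u_apply, hf k hk, mul_zero]

theorem rep_v_mul_mem_vanishingBelow {x : D q} (hx : rep q x f ∈ vanishingBelow m) :
    rep q (v q * x) f ∈ vanishingBelow (m - 1) := by
  rw [map_mul, rep_v, Module.End.mul_apply, genOp]
  exact diffOp_mem_vanishingBelow _ _ _ hx

theorem rep_w_mul_mem_vanishingBelow {x : D q} (hx : rep q x f ∈ vanishingBelow m) :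
    rep q (w q * x) f ∈ vanishingBelow (m - 1) := by
  rw [map_mul, rep_w, Module.End.mul_apply, genOp]
  exact diffOp_mem_vanishingBelow _ _ _ hx

theorem rep_v_mul_apply_sub_one {x : D q} (hx : rep q x f ∈ vanishingBelow m) :
    rep q (v q * x) f (m - 1) = rep q x f m := by
  rw [map_mul, rep_v, Module.End.mul_apply, genOp, diffOp_apply_sub_one _ _ _ hx, Pi.one_apply,
    one_mul]

theorem rep_w_mul_apply_sub_one {x : D q} (hx : rep q x f ∈ vanishingBelow m) :
    rep q (w q * x) f (m - 1) = -node m * rep q x f m := by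
  rw [map_mul, rep_w, Module.End.mul_apply, genOp, diffOp_apply_sub_one _ _ _ hx, sub_add_cancel]

theorem rep_mem_vanishingBelow {n : ℕ} {x : D q} (hx : x ∈ filtration q n)
    (hf : f ∈ vanishingBelow m) : rep q x f ∈ vanishingBelow (m - n) := by
  induction n generalizing x with
  | zero => simpa using rep_mem_vanishingBelow_of_mem_Cu hx hf
  | succ n ih =>
    obtain ⟨a, ha, b, hb, y, hy, rfl⟩ := mem_filtration_succ.1 hx
    have hv := rep_v_mul_mem_vanishingBelow (ih hy)
    have hw := rep_w_mul_mem_vanishingBelow (rep_mem_vanishingBelow_of_mem_Cu hb hf)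
    rw [sub_sub] at hv
    push_cast
    rw [map_add, map_add]
    exact add_mem (add_mem
      (vanishingBelow_antitone (by lia) (rep_mem_vanishingBelow_of_mem_Cu ha hf))
      (vanishingBelow_antitone (by lia) hw)) hv

theorem mem_Cu_of_rep_single_apply_eq_zero {x : D q} (hx : x ∈ filtration q 1)
    (h : ∀ m, rep q x (Pi.single m 1) (m - 1) = 0) : x ∈ Cu q := by
  obtain ⟨a, ha, b, hb, c, hc, rfl⟩ := mem_filtration_succ.1 hx
  obtain ⟨g, rfl⟩ := exists_aeval_u_of_mem_Cu hb
  obtain ⟨f, rfl⟩ := exists_aeval_u_of_mem_Cu hc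
  have hfg (m : ℤ) : f.eval (node m ^ 2) = g.eval (node m ^ 2) * node m := by
    have hδ := single_mem_vanishingBelow m
    have hm := h m
    simp only [map_add, LinearMap.add_apply, Pi.add_apply] at hm
    rw [mem_vanishingBelow.1 (rep_mem_vanishingBelow_of_mem_Cu ha hδ) (m - 1) (by lia),
      rep_w_mul_apply_sub_one (rep_mem_vanishingBelow_of_mem_Cu hb hδ),
      rep_v_mul_apply_sub_one (rep_mem_vanishingBelow_of_mem_Cu hc hδ),
      rep_aeval_u_apply, rep_aeval_u_apply, Pi.single_eq_same] at hm
    linear_combination hm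
  obtain ⟨rfl, rfl⟩ := eq_zero_of_eval_node_sq hfg
  simpa using ha

theorem mem_filtration_of_rep_single_apply_eq_zero {n : ℕ} {x : D q}
    (hx : x ∈ filtration q (n + 1))
    (h : ∀ m : ℤ, rep q x (Pi.single m 1) (m - (n + 1)) = 0) : x ∈ filtration q n := by
  induction n generalizing x with
  | zero => exact mem_Cu_of_rep_single_apply_eq_zero hx (by simpa using h)
  | succ n ih =>
    obtain ⟨a, ha, b, hb, y, hy, rfl⟩ := mem_filtration_succ.1 hx
    refine mem_filtration_succ.2 ⟨a, ha, b, hb, y, ih hy fun m => ?_, rfl⟩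
    have hδ := single_mem_vanishingBelow m
    have hab : rep q (a + w q * b) (Pi.single m 1) ∈ vanishingBelow (m - 1) := by
      rw [map_add]
      exact add_mem (vanishingBelow_antitone (by lia) (rep_mem_vanishingBelow_of_mem_Cu ha hδ))
        (rep_w_mul_mem_vanishingBelow (rep_mem_vanishingBelow_of_mem_Cu hb hδ))
    have hm := h m
    rw [map_add, LinearMap.add_apply, Pi.add_apply, mem_vanishingBelow.1 hab _ (by lia), zero_add,
      ← sub_sub] at hm
    have hy_lead := rep_v_mul_apply_sub_one (rep_mem_vanishingBelow hy hδ)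
    push_cast at hm hy_lead
    rw [← hy_lead, hm]

end LeadingCoefficients

section Centralizer

variable {q : ℂ[X]}

theorem genOp_u_single (m : ℤ) :
    genOp q .u (Pi.single m 1) = node m ^ 2 • (Pi.single m 1 : ℤ → ℂ) := by
  ext k
  rcases eq_or_ne k m with rfl | hk <;> simp [genOp_u_apply, *]

theorem rep_single_apply_eq_zero_of_commute {x : D q} (hx : Commute x (u q)) {m k : ℤ}
    (hk : k ≠ m) : rep q x (Pi.single m 1) k = 0 := by
  have h := congrArg (fun y => rep q y (Pi.single m 1) k) hx.eq
  simp only [map_mul, Module.End.mul_apply, rep_u, genOp_u_single, map_smul, Pi.smul_apply,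
    smul_eq_mul, genOp_u_apply] at h
  by_contra hne
  exact hk (node_sq_injective (mul_right_cancel₀ hne h.symm))

theorem mem_Cu_of_commute {x : D q} (hx : Commute x (u q)) : x ∈ Cu q := by
  obtain ⟨n, hn⟩ := exists_mem_filtration x
  induction n with
  | zero => exact hn
  | succ n ih =>
    exact ih (mem_filtration_of_rep_single_apply_eq_zero hn fun m =>
      rep_single_apply_eq_zero_of_commute hx (by lia))

end Centralizer

end

end KleinianD

theorem mainTheorem7_general (q : Polynomial ℂ) :
    KleinianD.IsMaximalCommutative (KleinianD.Cu q) :=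
  KleinianD.isMaximalCommutative_adjoin_singleton fun _ hx =>
    KleinianD.mem_Cu_of_commute (Subalgebra.mem_centralizer_iff ℂ |>.1 hx _ rfl).symm

theorem mainTheorem7 (q : Polynomial ℂ) (hq : 4 ≤ q.natDegree) :
    KleinianD.IsMaximalCommutative (KleinianD.Cu q) :=
  mainTheorem7_general q
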